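/- A Type A model is a pair $\mathcal M=(\mathbb R^2,\nabla)$, where $\nabla$ is a torsion free connection on the tangent bundle of $\mathbb R^2$ whose Christoffel symbols $\Gamma_{ij}{}^k=\Gamma_{ji}{}^k$ (given by $\nabla_{\partial_{x^i}}\partial_{x^j}=\Gamma_{ij}{}^k\partial_{x^k}$) are constant. Let $\mathcal M(a,b,c,d,e,f)$ be the Type A model with $\Gamma_{11}{}^1=a$, $\Gamma_{11}{}^2=b$, $\Gamma_{12}{}^1=\Gamma_{21}{}^1=c$, $\Gamma_{12}{}^2=\Gamma_{21}{}^2=d$, $\Gamma_{22}{}^1=e$, $\Gamma_{22}{}^2=f$. Two Type A models are linearly equivalent if an element of $\operatorname{GL}(2,\mathbb R)$, acting as a linear change of variables on $\mathbb R^2$, carries one connection to the other. Let $R(X,Y)=\nabla_X\nabla_Y-\nabla_Y\nabla_X-\nabla_{[X,Y]}$, let $\rho(X,Y)=\operatorname{Tr}\{Z\mapsto R(Z,X)Y\}$ be the Ricci tensor, $\rho_s$ its symmetrization, and let $\mathcal Q(\mathcal M)$ be the space of smooth functions $f:\mathbb R^2\to\mathbb R$ that satisfy the quasi-Einstein equation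 $\partial_{x^i}\partial_{x^j}f-\Gamma_{ij}{}^k\partial_{x^k}f+f\,(\rho_s)_{ij}=0$ for all $i,j$. Write $\mathcal S(f_1,f_2,f_3)$ for the real span of three functions. Consider the following models and function spaces, where $c_1\notin\{0,-1\}$, $c_2\neq0$ and $c\in\mathbb R$. * $\mathcal M_0^0=\mathcal M(0,0,0,0,0,0)$, $\mathcal Q_0^0=\mathcal S(1,x^1,x^2)$; * $\mathcal M_1^0=\mathcal M(1,0,0,1,0,0)$, $\mathcal Q_1^0=\mathcal S(1,e^{x^1},x^2e^{x^1})$; * $\mathcal M_2^0=\mathcal M(-1,0,0,0,0,1)$, $\mathcal Q_2^0=\mathcal S(1,e^{x^2},e^{-x^1})$; * $\mathcal M_3^0=\mathcal M(0,0,0,0,0,1)$, $\mathcal Q_3^0=\mathcal S(1,x^1,e^{x^2})$; * $\mathcal M_4^0=\mathcal M(0,0,0,0,1,0)$, $\mathcal Q_4^0=\mathcal S(1,x^2,(x^2)^2+2x^1)$; * $\mathcal M_5^0=\mathcal M(1,0,0,1,-1,0)$, $\mathcal Q_5^0=\mathcal S(1,e^{x^1}\cos x^2,e^{x^1}\sin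 x^2)$; * $\mathcal M_1^1=\mathcal M(-1,0,1,0,0,2)$, $\mathcal Q_1^1=e^{x^2}\mathcal S(1,x^2,e^{-x^1})$; * $\mathcal M_2^1(c_1)=\mathcal M(-1,0,c_1,0,0,1+2c_1)$, $\mathcal Q_2^1(c_1)=e^{c_1x^2}\mathcal S(1,e^{x^2},e^{-x^1})$; * $\mathcal M_3^1(c_1)=\mathcal M(0,0,c_1,0,0,1+2c_1)$, $\mathcal Q_3^1(c_1)=e^{c_1x^2}\mathcal S(1,e^{x^2},x^1)$; * $\mathcal M_4^1(c)=\mathcal M(0,0,1,0,c,2)$, $\mathcal Q_4^1(c)=e^{x^2}\mathcal S(1,x^2,c(x^2)^2+2x^1)$; * $\mathcal M_5^1(c)=\mathcal M(1,0,0,0,1+c^2,2c)$, $\mathcal Q_5^1(c)=\mathcal S(e^{cx^2}\cos x^2,e^{cx^2}\sin x^2,e^{x^1})$; * $\mathcal M_1^2(a_1,a_2)=\mathcal M\left(\frac{a_1^2+a_2-1}{D},\frac{a_1^2-a_1}{D},\frac{a_1a_2}{D},\frac{a_1a_2}{D},\frac{a_2^2-a_2}{D},\frac{a_1+a_2^2-1}{D}\right)$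 with $D=a_1+a_2-1$, $\mathcal Q_1^2(a_1,a_2)=\mathcal S(e^{x^1},e^{x^2},e^{a_1x^1+a_2x^2})$, for $a_1a_2\neq0$ and $a_1+a_2\neq1$; * $\mathcal M_2^2(b_1,b_2)=\mathcal M\left(1+b_1,0,b_2,1,\frac{1+b_2^2}{b_1-1},0\right)$, $\mathcal Q_2^2(b_1,b_2)=\mathcal S(e^{x^1}\cos x^2,e^{x^1}\sin x^2,e^{b_1x^1+b_2x^2})$, for $b_1\neq1$ and $(b_1,b_2)\neq(0,0)$; * $\mathcal M_3^2(c_2)=\mathcal M(2,0,0,1,c_2,1)$, $\mathcal Q_3^2(c_2)=e^{x^1}\mathcal S(1,x^1-c_2x^2,e^{x^2})$; * $\mathcal M_4^2(\pm1)=\mathcal M(2,0,0,1,\pm1,0)$, $\mathcal Q_4^2(\pm1)=\mathcal S(e^{x^1},x^2e^{x^1},(2x^1\pm(x^2)^2)e^{x^1})$. Then every Type A model is linearly equivalent to one of the models $\mathcal M_i^\nu(\cdot)$ in this list. Moreover, for every model in the list, $\mathcal Q(\mathcal M_i^\nu(\cdot))=\mathcal Q_i^\nu(\cdot)$, this space has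 dimension $3$, and the Ricci tensor of $\mathcal M_i^\nu(\cdot)$ has rank $\nu$ at every point. -/

import Mathlib

open scoped ContDiff

noncomputable section

namespace AffinePlane

/-- The coordinate plane `ℝ²`; the coordinates `x¹, x²` of a point `x` are `x 0, x 1`. -/
abbrev Plane : Type := Fin 2 → ℝ

/-- The coordinate vector `∂_{xⁱ}`. -/
def basisVec (i : Fin 2) : Plane := Pi.single i 1

/-- The partial derivative `∂_{xⁱ} f`. -/
def pderiv (i : Fin 2) (f : Plane → ℝ) : Plane → ℝ := fun x => fderiv ℝ f x (basisVec i)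

/-- A smooth torsion free connection on the tangent bundle of `ℝ²`, given by its Christoffel symbols
`Γ i j k = Γ_{ij}^k` with respect to the standard coordinates. -/
structure Connection where
  Γ : Fin 2 → Fin 2 → Fin 2 → Plane → ℝ
  smooth : ∀ i j k, ContDiff ℝ ∞ (Γ i j k)
  symm : ∀ i j k, Γ i j k = Γ j i k

namespace Connection

/-- The covariant derivative `∇_X Y` of vector fields on `ℝ²`, so that
`∇_{∂_i} ∂_j = ∑ k, Γ_{ij}^k ∂_k`. -/
def cov (M : Connection) (X Y : Plane → Plane) : Plane → Plane :=
  fun x k => fderiv ℝ Y x (X x) k + ∑ i, ∑ j, M.Γ i j k x * X x i * Y x j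

/-- The curvature operator `R(X, Y) Z = ∇_X ∇_Y Z - ∇_Y ∇_X Z - ∇_{[X, Y]} Z`. -/
def curvature (M : Connection) (X Y Z : Plane → Plane) : Plane → Plane :=
  M.cov X (M.cov Y Z) - M.cov Y (M.cov X Z) - M.cov (VectorField.lieBracket ℝ X Y) Z

/-- The Ricci tensor `ρ(u, v) = Tr (w ↦ R(w, u) v)` at the point `p`. As `R` is tensorial, it is
evaluated on the constant extensions of tangent vectors. -/
def ricci (M : Connection) (p u v : Plane) : ℝ :=
  Matrix.trace (Matrix.of fun k l : Fin 2 =>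
    M.curvature (fun _ => basisVec l) (fun _ => u) (fun _ => v) p k)

/-- The matrix `ρ_{ij}` of the Ricci tensor at `p`. -/
def ricciMatrix (M : Connection) (p : Plane) : Matrix (Fin 2) (Fin 2) ℝ :=
  Matrix.of fun i j => M.ricci p (basisVec i) (basisVec j)

/-- The matrix of the symmetric Ricci tensor `ρ_s` at `p`. -/
def symRicciMatrix (M : Connection) (p : Plane) : Matrix (Fin 2) (Fin 2) ℝ :=
  (1 / 2 : ℝ) • (M.ricciMatrix p + (M.ricciMatrix p).transpose)

/-- The Hessian `(H f)_{ij} = ∂_i ∂_j f - Γ_{ij}^k ∂_k f` at `p`. -/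
def hessian (M : Connection) (f : Plane → ℝ) (p : Plane) : Matrix (Fin 2) (Fin 2) ℝ :=
  Matrix.of fun i j => pderiv i (pderiv j f) p - ∑ k, M.Γ i j k p * pderiv k f p

end Connection

theorem pderiv_add (i : Fin 2) {f g : Plane → ℝ} (hf : Differentiable ℝ f)
    (hg : Differentiable ℝ g) : pderiv i (f + g) = pderiv i f + pderiv i g := by
  funext x
  simp [pderiv, fderiv_add (hf x) (hg x)]

theorem pderiv_smul (i : Fin 2) (c : ℝ) {f : Plane → ℝ} (hf : Differentiable ℝ f) :
    pderiv i (c • f) = c • pderiv i f := by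
  funext x
  simp [pderiv, fderiv_const_smul (hf x) c]

theorem contDiff_pderiv (i : Fin 2) {f : Plane → ℝ} (hf : ContDiff ℝ ∞ f) :
    ContDiff ℝ ∞ (pderiv i f) :=
  (hf.fderiv_right (m := ∞) (by norm_num)).clm_apply contDiff_const

namespace Connection

/-- The space `Q(M)` of smooth solutions `f : ℝ² → ℝ` of the quasi-Einstein equation
`H f + f ρ_s = 0`. -/
def quasiEinstein (M : Connection) : Submodule ℝ (Plane → ℝ) where
  carrier := {f | ContDiff ℝ ∞ f ∧ ∀ p, M.hessian f p + f p • M.symRicciMatrix p = 0}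
  add_mem' := by
    rintro f g ⟨hf, hf'⟩ ⟨hg, hg'⟩
    refine ⟨hf.add hg, fun p => ?_⟩
    have df := hf.differentiable (by norm_num)
    have dg := hg.differentiable (by norm_num)
    rw [← add_zero (0 : Matrix (Fin 2) (Fin 2) ℝ)]
    nth_rewrite 1 [← hf' p]
    rw [← hg' p]
    ext i j
    simp only [hessian, pderiv_add _ df dg,
      pderiv_add _ ((contDiff_pderiv j hf).differentiable (by norm_num))
        ((contDiff_pderiv j hg).differentiable (by norm_num)),
      Matrix.add_apply, Matrix.of_apply, Matrix.smul_apply, Pi.add_apply, smul_eq_mul,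
      Fin.sum_univ_two]
    ring
  zero_mem' := by
    refine ⟨contDiff_const, fun p => ?_⟩
    have h : ∀ i, pderiv i 0 = 0 := fun i => by
      funext x
      simp [pderiv]
    ext i j
    simp [hessian, h]
  smul_mem' := by
    rintro c f ⟨hf, hf'⟩
    refine ⟨hf.const_smul c, fun p => ?_⟩
    have df := hf.differentiable (by norm_num)
    rw [← smul_zero c, ← hf' p]
    ext i j
    simp only [hessian, pderiv_smul _ c df,
      pderiv_smul _ c ((contDiff_pderiv j hf).differentiable (by norm_num)),
      Matrix.add_apply, Matrix.of_apply, Matrix.smul_apply, Pi.smul_apply, smul_eq_mul,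
      Fin.sum_univ_two]
    ring

/-- `M` is a Type A model: its Christoffel symbols are constant. -/
def IsTypeA (M : Connection) : Prop :=
  ∃ C : Fin 2 → Fin 2 → Fin 2 → ℝ, ∀ i j k p, M.Γ i j k p = C i j k

end Connection

/-- The Type A model `M(a, b, c, d, e, f)` with `Γ₁₁¹ = a`, `Γ₁₁² = b`, `Γ₁₂¹ = Γ₂₁¹ = c`,
`Γ₁₂² = Γ₂₁² = d`, `Γ₂₂¹ = e`, `Γ₂₂² = f`. -/
def typeA (a b c d e f : ℝ) : Connection where
  Γ i j k := fun _ => (![![![a, b], ![c, d]], ![![c, d], ![e, f]]] :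
    Fin 2 → Fin 2 → Fin 2 → ℝ) i j k
  smooth _ _ _ := contDiff_const
  symm i j k := by
    fin_cases i <;> fin_cases j <;> rfl

/-- The push-forward of a vector field under a linear change of variables. -/
def pushforward (T : Plane ≃L[ℝ] Plane) (X : Plane → Plane) : Plane → Plane :=
  fun y => T (X (T.symm y))

/-- `M` and `N` are linearly equivalent: some element of `GL(2, ℝ)`, as a change of variables,
carries the connection of `M` to that of `N`. -/
def LinearlyEquivalent (M N : Connection) : Prop :=
  ∃ T : Plane ≃L[ℝ] Plane, ∀ X Y : Plane → Plane, ContDiff ℝ ∞ X → ContDiff ℝ ∞ Y →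
    pushforward T (M.cov X Y) = N.cov (pushforward T X) (pushforward T Y)

/-- The real span of three functions. -/
def S (f₁ f₂ f₃ : Plane → ℝ) : Submodule ℝ (Plane → ℝ) := Submodule.span ℝ {f₁, f₂, f₃}

/-- Names of the listed models: `mνi` stands for the model with upper index `ν` and lower
index `i`. -/
inductive Label where
  | m00 | m01 | m02 | m03 | m04 | m05
  | m11
  | m12 (c₁ : ℝ)
  | m13 (c₁ : ℝ)
  | m14 (c : ℝ)
  | m15 (c : ℝ)
  | m21 (a₁ a₂ : ℝ)
  | m22 (b₁ b₂ : ℝ)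
  | m23 (c₂ : ℝ)
  | m24 (s : ℝ)

namespace Label

/-- The restrictions on the parameters. -/
def Admissible : Label → Prop
  | m12 c₁ => c₁ ≠ 0 ∧ c₁ ≠ -1
  | m13 c₁ => c₁ ≠ 0 ∧ c₁ ≠ -1
  | m21 a₁ a₂ => a₁ * a₂ ≠ 0 ∧ a₁ + a₂ ≠ 1
  | m22 b₁ b₂ => b₁ ≠ 1 ∧ (b₁, b₂) ≠ (0, 0)
  | m23 c₂ => c₂ ≠ 0
  | m24 s => s = 1 ∨ s = -1
  | _ => True

/-- The upper index `ν`. -/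
def nu : Label → ℕ
  | m00 | m01 | m02 | m03 | m04 | m05 => 0
  | m11 | m12 _ | m13 _ | m14 _ | m15 _ => 1
  | m21 _ _ | m22 _ _ | m23 _ | m24 _ => 2

/-- The model `M_i^ν(·)`. -/
def model : Label → Connection
  | m00 => typeA 0 0 0 0 0 0
  | m01 => typeA 1 0 0 1 0 0
  | m02 => typeA (-1) 0 0 0 0 1
  | m03 => typeA 0 0 0 0 0 1
  | m04 => typeA 0 0 0 0 1 0
  | m05 => typeA 1 0 0 1 (-1) 0
  | m11 => typeA (-1) 0 1 0 0 2
  | m12 c₁ => typeA (-1) 0 c₁ 0 0 (1 + 2 * c₁)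
  | m13 c₁ => typeA 0 0 c₁ 0 0 (1 + 2 * c₁)
  | m14 c => typeA 0 0 1 0 c 2
  | m15 c => typeA 1 0 0 0 (1 + c ^ 2) (2 * c)
  | m21 a₁ a₂ => typeA
      ((a₁ ^ 2 + a₂ - 1) / (a₁ + a₂ - 1)) ((a₁ ^ 2 - a₁) / (a₁ + a₂ - 1))
      (a₁ * a₂ / (a₁ + a₂ - 1)) (a₁ * a₂ / (a₁ + a₂ - 1))
      ((a₂ ^ 2 - a₂) / (a₁ + a₂ - 1)) ((a₁ + a₂ ^ 2 - 1) / (a₁ + a₂ - 1))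
  | m22 b₁ b₂ => typeA (1 + b₁) 0 b₂ 1 ((1 + b₂ ^ 2) / (b₁ - 1)) 0
  | m23 c₂ => typeA 2 0 0 1 c₂ 1
  | m24 s => typeA 2 0 0 1 s 0

open Real in
/-- The function space `Q_i^ν(·)`. -/
def space : Label → Submodule ℝ (Plane → ℝ)
  | m00 => S (fun _ => 1) (fun x => x 0) (fun x => x 1)
  | m01 => S (fun _ => 1) (fun x => exp (x 0)) (fun x => x 1 * exp (x 0))
  | m02 => S (fun _ => 1) (fun x => exp (x 1)) (fun x => exp (-x 0))
  | m03 => S (fun _ => 1) (fun x => x 0) (fun x => exp (x 1))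
  | m04 => S (fun _ => 1) (fun x => x 1) (fun x => x 1 ^ 2 + 2 * x 0)
  | m05 => S (fun _ => 1) (fun x => exp (x 0) * cos (x 1)) (fun x => exp (x 0) * sin (x 1))
  | m11 => S (fun x => exp (x 1)) (fun x => exp (x 1) * x 1) (fun x => exp (x 1) * exp (-x 0))
  | m12 c₁ => S (fun x => exp (c₁ * x 1)) (fun x => exp (c₁ * x 1) * exp (x 1))
      (fun x => exp (c₁ * x 1) * exp (-x 0))
  | m13 c₁ => S (fun x => exp (c₁ * x 1)) (fun x => exp (c₁ * x 1) * exp (x 1))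
      (fun x => exp (c₁ * x 1) * x 0)
  | m14 c => S (fun x => exp (x 1)) (fun x => exp (x 1) * x 1)
      (fun x => exp (x 1) * (c * x 1 ^ 2 + 2 * x 0))
  | m15 c => S (fun x => exp (c * x 1) * cos (x 1)) (fun x => exp (c * x 1) * sin (x 1))
      (fun x => exp (x 0))
  | m21 a₁ a₂ => S (fun x => exp (x 0)) (fun x => exp (x 1)) (fun x => exp (a₁ * x 0 + a₂ * x 1))
  | m22 b₁ b₂ => S (fun x => exp (x 0) * cos (x 1)) (fun x => exp (x 0) * sin (x 1))
      (fun x => exp (b₁ * x 0 + b₂ * x 1))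
  | m23 c₂ => S (fun x => exp (x 0)) (fun x => exp (x 0) * (x 0 - c₂ * x 1))
      (fun x => exp (x 0) * exp (x 1))
  | m24 s => S (fun x => exp (x 0)) (fun x => x 1 * exp (x 0))
      (fun x => (2 * x 0 + s * x 1 ^ 2) * exp (x 0))

end Label

end AffinePlane

end

namespace AffinePlane

/-! Constant Christoffel symbols are a commutative product `m` on the plane, and linear equivalence
is isomorphism of such products. For a linear form `φ`, the function `e^φ` solves the quasi-Einstein
equation exactly when `φ (m u v) - φ u * φ v = ρ_s(u, v)`, that is, when `φ` extended by `1 ↦ 1` is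
a character of the unital algebra `ℝ ⊕ ℝ²` with product `u · v = m u v - ρ_s(u, v) 1`. This algebra
is commutative and associative of dimension 3. Either some `w` has `w` and `m w w` independent, and
the algebra is `ℝ[t]/(cubic)` with `t = w`; or `m u v = l u • v + l v • u` for a linear form `l`.

In the cyclic case a real cubic has one of four root patterns, giving `ℝ³`, `ℝ × ℂ`, `ℝ × ℝ[ε]` and
`ℝ[t]/(t³)`. Within each pattern the characters are affinely independent points of the dual plane
(repeated roots contributing tangent data), and the position of the origin relative to them selects
the listed model: generic position gives rank 2, the origin on a distinguished line gives rank 1,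
the origin at a character gives rank 0. Suitable coordinates are read off from the exponents in the
listed solution spaces. The proof checks the resulting identities directly and never invokes
associativity (`isListed_of_cubic`, `isListed_christoffelMul`).

For the solution spaces, all second derivatives of a solution are determined by its 1-jet, so a
solution is fixed by its 1-jet at the origin and the dimension is at most 3. Three explicit
solutions with independent jets then span (`quasiEinstein_eq_S`). -/

/-! ### Linear coordinates and multiplication tables -/

theorem cov_typeA_apply_zero (a b c d e f : ℝ) (X Y : Plane → Plane) (p : Plane) :
    (typeA a b c d e f).cov X Y p 0 = fderiv ℝ Y p (X p) 0 +
      (a * X p 0 * Y p 0 + c * (X p 0 * Y p 1 + X p 1 * Y p 0) + e * X p 1 * Y p 1) := by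
  simp [Connection.cov, typeA, Fin.sum_univ_two]
  ring

theorem cov_typeA_apply_one (a b c d e f : ℝ) (X Y : Plane → Plane) (p : Plane) :
    (typeA a b c d e f).cov X Y p 1 = fderiv ℝ Y p (X p) 1 +
      (b * X p 0 * Y p 0 + d * (X p 0 * Y p 1 + X p 1 * Y p 0) + f * X p 1 * Y p 1) := by
  simp [Connection.cov, typeA, Fin.sum_univ_two]
  ring

/-- The commutative product `u * v = ∑ Γ_{ij}^k u_i v_j ∂_k` given by Christoffel symbols. -/
def christoffelMul (C : Fin 2 → Fin 2 → Fin 2 → ℝ) (u v : Plane) : Plane :=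
  fun k => ∑ i, ∑ j, C i j k * u i * v j

/-- The linear forms `x, y` have the multiplication table `(a, b, c, d, e, f)` with respect to the
product `m`, and form a coordinate system. -/
structure HasTable (m : Plane → Plane → Plane) (x y : Plane →ₗ[ℝ] ℝ) (a b c d e f : ℝ) :
    Prop where
  sep : ∀ u, x u = 0 → y u = 0 → u = 0
  fst : ∀ u v, x (m u v) = a * x u * x v + c * (x u * y v + y u * x v) + e * y u * y v
  snd : ∀ u v, y (m u v) = b * x u * x v + d * (x u * y v + y u * x v) + f * y u * y v

/-- The derivative part of the covariant derivative commutes with any linear change of variables, so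
only the bilinear part has to match; the change of variables is `u ↦ (x u, y u)`. -/
theorem HasTable.linearlyEquivalent {M : Connection} {C : Fin 2 → Fin 2 → Fin 2 → ℝ}
    (hC : ∀ i j k p, M.Γ i j k p = C i j k) {x y : Plane →ₗ[ℝ] ℝ} {a b c d e f : ℝ}
    (h : HasTable (christoffelMul C) x y a b c d e f) :
    LinearlyEquivalent M (typeA a b c d e f) := by
  let F : Plane →ₗ[ℝ] Plane := LinearMap.pi ![x, y]
  have hF0 : ∀ u, F u 0 = x u := fun u => rfl
  have hF1 : ∀ u, F u 1 = y u := fun u => rfl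
  have hinj : Function.Injective F := by
    rw [injective_iff_map_eq_zero]
    intro u hu
    exact h.sep u (by rw [← hF0, hu]; rfl) (by rw [← hF1, hu]; rfl)
  let T : Plane ≃L[ℝ] Plane := (LinearEquiv.ofInjectiveEndo F hinj).toContinuousLinearEquiv
  have hT0 : ∀ u, T u 0 = x u := fun u => rfl
  have hT1 : ∀ u, T u 1 = y u := fun u => rfl
  refine ⟨T, fun X Y hX hY => ?_⟩
  funext z
  have hder : fderiv ℝ (pushforward T Y) z (pushforward T X z)
      = T (fderiv ℝ Y (T.symm z) (X (T.symm z))) := by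
    have hYd : DifferentiableAt ℝ Y (T.symm z) := hY.differentiable (by norm_num) _
    have : HasFDerivAt (pushforward T Y)
        ((T : Plane →L[ℝ] Plane).comp ((fderiv ℝ Y (T.symm z)).comp
          (T.symm : Plane →L[ℝ] Plane))) z :=
      (T : Plane →L[ℝ] Plane).hasFDerivAt.comp z
        (hYd.hasFDerivAt.comp z (T.symm : Plane →L[ℝ] Plane).hasFDerivAt)
    rw [this.fderiv]
    simp [pushforward]
  have hcov : M.cov X Y (T.symm z) = fderiv ℝ Y (T.symm z) (X (T.symm z)) +
      christoffelMul C (X (T.symm z)) (Y (T.symm z)) := by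
    funext k
    simp [Connection.cov, christoffelMul, hC]
  have hl : pushforward T (M.cov X Y) z = T (M.cov X Y (T.symm z)) := rfl
  rw [hl, hcov, map_add]
  funext k
  fin_cases k
  · simp only [Fin.zero_eta, Fin.isValue]
    rw [cov_typeA_apply_zero, hder, Pi.add_apply, hT0 (christoffelMul _ _ _), h.fst]
    rfl
  · simp only [Fin.mk_one, Fin.isValue]
    rw [cov_typeA_apply_one, hder, Pi.add_apply, hT1 (christoffelMul _ _ _), h.snd]
    rfl

/-- Two linear forms on the plane without common zeros span all linear forms. -/
theorem exists_eq_add_of_sep {x y : Plane →ₗ[ℝ] ℝ} (h : ∀ u, x u = 0 → y u = 0 → u = 0)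
    (φ : Plane →ₗ[ℝ] ℝ) : ∃ s t : ℝ, ∀ u, φ u = s * x u + t * y u := by
  have hF : Function.Injective (LinearMap.pi ![x, y] : Plane →ₗ[ℝ] Plane) := by
    rw [injective_iff_map_eq_zero]
    intro u hu
    exact h u (congrFun hu 0) (congrFun hu 1)
  let T := LinearEquiv.ofInjectiveEndo _ hF
  refine ⟨φ (T.symm (Pi.single 0 1)), φ (T.symm (Pi.single 1 1)), fun u => ?_⟩
  have h1 : T u = x u • Pi.single 0 1 + y u • Pi.single 1 1 := by
    funext k
    fin_cases k
    · simp; rfl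
    · simp; rfl
  have h2 : u = x u • T.symm (Pi.single 0 1) + y u • T.symm (Pi.single 1 1) := by
    rw [← map_smul, ← map_smul, ← map_add, ← h1, T.symm_apply_apply]
  conv_lhs => rw [h2]
  simp [mul_comm]

/-! ### Normal forms for each type of algebra -/

/-- In suitable linear coordinates, the product `m` is given by the Christoffel symbols of one of
the listed models. -/
def IsListed (m : Plane → Plane → Plane) : Prop :=
  ∃ L : Label, L.Admissible ∧ ∃ (x y : Plane →ₗ[ℝ] ℝ) (a b c d e f : ℝ),
    L.model = typeA a b c d e f ∧ HasTable m x y a b c d e f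

variable {m : Plane → Plane → Plane}

/-- With `φ₁, φ₂` as coordinates, the two hypotheses are linear equations for `φ₁ (m u v)` and `φ₂
(m u v)` with determinant `1 - a₁ - a₂`, so they determine the whole table. -/
theorem isListed_of_independent_characters {φ₁ φ₂ φ₃ : Plane →ₗ[ℝ] ℝ} {a₁ a₂ : ℝ}
    (h₁₂ : ∀ u v, φ₁ (m u v) - φ₁ u * φ₁ v = φ₂ (m u v) - φ₂ u * φ₂ v)
    (h₁₃ : ∀ u v, φ₁ (m u v) - φ₁ u * φ₁ v = φ₃ (m u v) - φ₃ u * φ₃ v)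
    (sep : ∀ u, φ₁ u = 0 → φ₂ u = 0 → u = 0) (h : ∀ u, φ₃ u = a₁ * φ₁ u + a₂ * φ₂ u)
    (ha : a₁ * a₂ ≠ 0) (hD : a₁ + a₂ ≠ 1) : IsListed m := by
  have hD' : a₁ + a₂ - 1 ≠ 0 := sub_ne_zero.mpr hD
  refine ⟨.m21 a₁ a₂, ⟨ha, hD⟩, φ₁, φ₂, _, _, _, _, _, _, rfl, sep, fun u v => ?_, fun u v => ?_⟩
  all_goals
    have h1 := h₁₂ u v
    have h2 := h₁₃ u v
    simp only [h] at h2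
    field_simp
  · linear_combination (-1) * h2 + a₂ * h1
  · linear_combination (-1) * h2 + (1 - a₁) * h1

/-- Here the origin lies on the line through `φ₁` and `φ₂`; the values `c = 0` and `c = -1` put it
at one of these two points. -/
theorem isListed_of_two_dependent_characters {φ₁ φ₂ φ₃ : Plane →ₗ[ℝ] ℝ} {c : ℝ}
    (h₁₂ : ∀ u v, φ₁ (m u v) - φ₁ u * φ₁ v = φ₂ (m u v) - φ₂ u * φ₂ v)
    (h₁₃ : ∀ u v, φ₁ (m u v) - φ₁ u * φ₁ v = φ₃ (m u v) - φ₃ u * φ₃ v)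
    (sep : ∀ u, φ₁ u = φ₂ u → φ₁ u = φ₃ u → u = 0) (h : ∀ u, φ₁ u = c * (φ₂ u - φ₁ u)) :
    IsListed m := by
  have sep' : ∀ u, (φ₁ - φ₃) u = 0 → (φ₂ - φ₁) u = 0 → u = 0 := fun u h1 h2 =>
    sep u (sub_eq_zero.mp h2).symm (sub_eq_zero.mp h1)
  by_cases hc : c = 0
  · subst hc
    have h0 : ∀ u, φ₁ u = 0 := fun u => by rw [h]; ring
    refine ⟨.m02, trivial, φ₁ - φ₃, φ₂ - φ₁, _, _, _, _, _, _, rfl, sep',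
      fun u v => ?_, fun u v => ?_⟩
    all_goals
      have h1 := h₁₂ u v
      have h2 := h₁₃ u v
      simp only [h0, LinearMap.sub_apply] at *
    · linear_combination h2
    · linear_combination -h1
  by_cases hc' : c = -1
  · subst hc'
    have h0 : ∀ u, φ₂ u = 0 := fun u => by linear_combination h u
    refine ⟨.m02, trivial, φ₂ - φ₃, φ₁ - φ₂, _, _, _, _, _, _, rfl, fun u h1 h2 => ?_,
      fun u v => ?_, fun u v => ?_⟩
    · simp only [LinearMap.sub_apply] at h1 h2
      exact sep u (by linarith) (by linarith)
    all_goals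
      have h1 := h₁₂ u v
      have h2 := h₁₃ u v
      simp only [h0, LinearMap.sub_apply] at *
    · linear_combination h2 - h1
    · linear_combination h1
  · refine ⟨.m12 c, ⟨hc, hc'⟩, φ₁ - φ₃, φ₂ - φ₁, _, _, _, _, _, _, rfl, sep',
      fun u v => ?_, fun u v => ?_⟩
    all_goals
      have h1 := h₁₂ u v
      have h2 := h₁₃ u v
      have hu := h u
      have hv := h v
      simp only [LinearMap.sub_apply] at *
    · linear_combination h2 + (φ₁ u - φ₃ u) * hv + (φ₁ v - φ₃ v) * hu
    · linear_combination -h1 + (φ₂ v - φ₁ v) * hu + (φ₂ u - φ₁ u) * hv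

/-- The case of the algebra `ℝ × ℝ × ℝ`. -/
theorem isListed_of_three_characters {φ₁ φ₂ φ₃ : Plane →ₗ[ℝ] ℝ}
    (h₁₂ : ∀ u v, φ₁ (m u v) - φ₁ u * φ₁ v = φ₂ (m u v) - φ₂ u * φ₂ v)
    (h₁₃ : ∀ u v, φ₁ (m u v) - φ₁ u * φ₁ v = φ₃ (m u v) - φ₃ u * φ₃ v)
    (sep : ∀ u, φ₁ u = φ₂ u → φ₁ u = φ₃ u → u = 0) : IsListed m := by
  -- The barycentric coordinates of the origin with respect to `φ₁, φ₂, φ₃` are `1 - s + c`, `-c`,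
  -- `s`. If one vanishes, the two other characters are dependent.
  obtain ⟨s, c, h⟩ := exists_eq_add_of_sep (x := φ₁ - φ₃) (y := φ₂ - φ₁)
    (fun u h1 h2 => sep u (sub_eq_zero.mp h2).symm (sub_eq_zero.mp h1)) φ₁
  simp only [LinearMap.sub_apply] at h
  by_cases hs : s = 0
  · subst hs
    exact isListed_of_two_dependent_characters h₁₂ h₁₃ sep (c := c)
      (fun u => by linear_combination h u)
  by_cases hc : c = 0
  · subst hc
    exact isListed_of_two_dependent_characters h₁₃ h₁₂ (fun u h1 h2 => sep u h2 h1) (c := -s)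
      (fun u => by linear_combination h u)
  by_cases hp : 1 - s + c = 0
  · refine isListed_of_two_dependent_characters (φ₁ := φ₂) (φ₂ := φ₃) (φ₃ := φ₁)
      (fun u v => (h₁₂ u v).symm.trans (h₁₃ u v)) (fun u v => (h₁₂ u v).symm)
      (fun u h1 h2 => sep u h2.symm (h2.symm.trans h1)) (c := -s)
      (fun u => by linear_combination h u + (φ₂ u - φ₁ u) * hp)
  have h3 : ∀ u, φ₃ u = (s - c - 1) / s * φ₁ u + c / s * φ₂ u := fun u => by
    field_simp
    linear_combination h u
  refine isListed_of_independent_characters h₁₂ h₁₃ (fun u h1 h2 => ?_) h3 ?_ ?_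
  · exact sep u (h1.trans h2.symm) (by rw [h3, h1, h2]; ring)
  · have : s - c - 1 ≠ 0 := fun h' => hp (by linear_combination -h')
    positivity
  · intro h'
    field_simp at h'
    linarith

/-- The case of the algebra `ℝ × ℂ`. -/
theorem isListed_of_complex_character {φ α β : Plane →ₗ[ℝ] ℝ}
    (hα : ∀ u v, φ (m u v) - φ u * φ v = α (m u v) - (α u * α v - β u * β v))
    (hβ : ∀ u v, β (m u v) = α u * β v + β u * α v)
    (sep : ∀ u, φ u = α u → β u = 0 → u = 0) : IsListed m := by
  have sep' : ∀ u, (α - φ) u = 0 → β u = 0 → u = 0 := fun u h1 h2 =>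
    sep u (sub_eq_zero.mp h1).symm h2
  obtain ⟨s, t, h⟩ := exists_eq_add_of_sep sep' φ
  simp only [LinearMap.sub_apply] at h
  -- Since `(1 + s) φ = s α + t β`, this is the case where `α` is a multiple of `β`; otherwise `α,
  -- β` are coordinates.
  by_cases hs : 1 + s = 0
  · have h' : ∀ u, α u = t * β u := fun u => by linear_combination h u + (α u - φ u) * hs
    refine ⟨.m15 t, trivial, φ, β, _, _, _, _, _, _, rfl, fun u h1 h2 => ?_, fun u v => ?_,
      fun u v => ?_⟩
    · exact sep u (by rw [h', h1, h2]; ring) h2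
    all_goals
      have h1 := hα u v
      have h2 := hβ u v
      simp only [h'] at h1 h2
    · linear_combination h1 + t * h2
    · linear_combination h2
  have hφ : ∀ u, φ u = s / (1 + s) * α u + t / (1 + s) * β u := fun u => by
    field_simp
    linear_combination h u
  have hb : s / (1 + s) ≠ 1 := fun h' => by field_simp at h'; linarith
  generalize s / (1 + s) = b₁ at *
  generalize t / (1 + s) = b₂ at *
  have hb' : b₁ - 1 ≠ 0 := sub_ne_zero.mpr hb
  have sep2 : ∀ u, α u = 0 → β u = 0 → u = 0 := fun u h1 h2 =>
    sep u (by rw [hφ, h1, h2]; ring) h2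
  have key : HasTable m α β (1 + b₁) 0 b₂ 1 ((1 + b₂ ^ 2) / (b₁ - 1)) 0 := by
    refine ⟨sep2, fun u v => ?_, fun u v => ?_⟩
    all_goals
      have h1 := hα u v
      have h2 := hβ u v
      simp only [hφ] at h1
    · field_simp
      linear_combination h1 - b₂ * h2
    · linear_combination h2
  by_cases h0 : (b₁, b₂) = (0, 0)
  · obtain ⟨rfl, rfl⟩ := Prod.mk.inj h0
    refine ⟨.m05, trivial, α, β, _, _, _, _, _, _, rfl, ?_⟩
    convert key using 1 <;> norm_num
  · exact ⟨.m22 b₁ b₂, ⟨hb, h0⟩, α, β, _, _, _, _, _, _, rfl, key⟩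

/-- The case of the algebra `ℝ × ℝ[ε]`. -/
theorem isListed_of_derivation {φ₁ φ₂ δ : Plane →ₗ[ℝ] ℝ}
    (h₁₂ : ∀ u v, φ₁ (m u v) - φ₁ u * φ₁ v = φ₂ (m u v) - φ₂ u * φ₂ v)
    (hδ : ∀ u v, δ (m u v) = φ₂ u * δ v + δ u * φ₂ v)
    (sep : ∀ u, φ₁ u = φ₂ u → δ u = 0 → u = 0) : IsListed m := by
  have sep' : ∀ u, (φ₁ - φ₂) u = 0 → δ u = 0 → u = 0 := fun u h1 h2 =>
    sep u (sub_eq_zero.mp h1) h2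
  obtain ⟨p, q, h⟩ := exists_eq_add_of_sep sep' φ₂
  simp only [LinearMap.sub_apply] at h
  -- `q = 0` puts the origin on the line through `φ₁` and `φ₂`; `p = 0` puts it on the line through
  -- `φ₂` in the direction `δ`.
  by_cases hq : q = 0
  · subst hq
    by_cases hp : p = 0
    · subst hp
      have h0 : ∀ u, φ₂ u = 0 := fun u => by rw [h]; ring
      refine ⟨.m03, trivial, δ, φ₁, _, _, _, _, _, _, rfl, fun u h1 h2 => ?_, fun u v => ?_,
        fun u v => ?_⟩
      · exact sep u (by rw [h0, h2]) h1
      all_goals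
        have h1 := h₁₂ u v
        have h2 := hδ u v
        simp only [h0] at h1 h2
      · linear_combination h2
      · linear_combination h1
    by_cases hp' : p = -1
    · subst hp'
      have h0 : ∀ u, φ₁ u = 0 := fun u => by linear_combination h u
      refine ⟨.m01, trivial, φ₂, δ, _, _, _, _, _, _, rfl, fun u h1 h2 => ?_, fun u v => ?_,
        fun u v => ?_⟩
      · exact sep u (by rw [h0, h1]) h2
      all_goals
        have h1 := h₁₂ u v
        have h2 := hδ u v
        simp only [h0] at h1 h2
      · linear_combination -h1
      · linear_combination h2
    refine ⟨.m13 p, ⟨hp, hp'⟩, δ, φ₁ - φ₂, _, _, _, _, _, _, rfl, fun u h1 h2 => sep' u h2 h1,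
      fun u v => ?_, fun u v => ?_⟩
    all_goals
      have h1 := h₁₂ u v
      have h2 := hδ u v
      have hu : φ₂ u = p * (φ₁ u - φ₂ u) := by linear_combination h u
      have hv : φ₂ v = p * (φ₁ v - φ₂ v) := by linear_combination h v
      simp only [LinearMap.sub_apply]
    · linear_combination h2 + δ v * hu + δ u * hv
    · linear_combination h1 + (φ₁ v - φ₂ v) * hu + (φ₁ u - φ₂ u) * hv
  by_cases hp : p = 0
  · subst hp
    have h' : ∀ u, δ u = φ₂ u / q := fun u => by
      field_simp
      linear_combination -(h u)
    refine ⟨.m11, trivial, φ₂ - φ₁, φ₂, _, _, _, _, _, _, rfl, fun u h1 h2 => ?_,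
      fun u v => ?_, fun u v => ?_⟩
    · exact sep u (sub_eq_zero.mp h1).symm (by rw [h', h2, zero_div])
    all_goals
      have h1 := h₁₂ u v
      have h2 := hδ u v
      simp only [h'] at h2
      field_simp at h2
      simp only [LinearMap.sub_apply]
    · linear_combination -h1
    · linear_combination h2
  · refine ⟨.m23 p, hp, φ₂, φ₁ - φ₂, _, _, _, _, _, _, rfl, fun u h1 h2 => ?_,
      fun u v => ?_, fun u v => ?_⟩
    · refine sep' u h2 ?_
      have h3 := h u
      simp only [LinearMap.sub_apply] at h2
      rw [h2, h1] at h3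
      simpa [hq] using h3.symm
    all_goals
      have h1 := h₁₂ u v
      have h2 := hδ u v
      have h3 := h (m u v)
      have hu : q * δ u = φ₂ u - p * (φ₁ u - φ₂ u) := by linear_combination -(h u)
      have hv : q * δ v = φ₂ v - p * (φ₁ v - φ₂ v) := by linear_combination -(h v)
      simp only [LinearMap.sub_apply]
    · linear_combination h3 + q * h2 + φ₂ v * hu + φ₂ u * hv + p * h1
    · linear_combination h1

/-- The case of the algebra `ℝ[t]/(t³)`. -/
theorem isListed_of_second_order_derivation {φ δ₁ δ₂ : Plane →ₗ[ℝ] ℝ}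
    (h₁ : ∀ u v, δ₁ (m u v) = φ u * δ₁ v + δ₁ u * φ v)
    (h₂ : ∀ u v, δ₂ (m u v) = φ u * δ₂ v + δ₁ u * δ₁ v + δ₂ u * φ v)
    (sep : ∀ u, δ₁ u = 0 → δ₂ u = 0 → u = 0) : IsListed m := by
  obtain ⟨p, q, h⟩ := exists_eq_add_of_sep sep φ
  by_cases hq : q = 0
  · subst hq
    by_cases hp : p = 0
    · subst hp
      have h0 : ∀ u, φ u = 0 := fun u => by rw [h]; ring
      refine ⟨.m04, trivial, δ₂, δ₁, _, _, _, _, _, _, rfl, fun u h1 h2 => sep u h2 h1,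
        fun u v => ?_, fun u v => ?_⟩
      · rw [h₂, h0, h0]; ring
      · rw [h₁, h0, h0]; ring
    · have h' : ∀ u, δ₁ u = φ u / p := fun u => by
        field_simp
        linear_combination -(h u)
      -- As `φ = p δ₁`, the factor `p ^ 2` turns the term `δ₁ u * δ₁ v` into `φ u * φ v` with
      -- coefficient 1. The parameter 0 comes from the non-cyclic case.
      refine ⟨.m14 1, trivial, p ^ 2 • δ₂, φ, _, _, _, _, _, _, rfl, fun u h1 h2 => ?_,
        fun u v => ?_, fun u v => ?_⟩
      · refine sep u (by rw [h', h2, zero_div]) ?_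
        simpa [hp] using h1
      · have h2 := h₂ u v
        simp only [h'] at h2
        field_simp at h2
        simp only [LinearMap.smul_apply, smul_eq_mul]
        linear_combination h2
      · have h1 := h₁ u v
        simp only [h'] at h1
        field_simp at h1
        linear_combination h1
  -- Rescaling `δ₁` by `k = √|q|` reduces `q` to its sign `s`.
  · have key : ∀ s k : ℝ, s * k ^ 2 = q → k ≠ 0 →
        HasTable m φ (k • δ₁) 2 0 0 1 s 0 := by
      intro s k hk hk0
      refine ⟨fun u h1 h2 => ?_, fun u v => ?_, fun u v => ?_⟩
      · have h3 : δ₁ u = 0 := by simpa [hk0] using h2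
        refine sep u h3 ?_
        have h4 := h u
        rw [h1, h3] at h4
        simpa [hq] using h4.symm
      · have hm := h (m u v)
        have hu := h u
        have hv := h v
        simp only [LinearMap.smul_apply, smul_eq_mul]
        linear_combination hm + p * h₁ u v + q * h₂ u v - φ v * hu - φ u * hv -
          δ₁ u * δ₁ v * hk
      · have h1 := h₁ u v
        simp only [LinearMap.smul_apply, smul_eq_mul]
        linear_combination k * h1
    rcases lt_or_gt_of_ne hq with hneg | hpos
    · refine ⟨.m24 (-1), Or.inr rfl, _, _, _, _, _, _, _, _, rfl, key (-1) √(-q) ?_ ?_⟩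
      · rw [Real.sq_sqrt (by linarith)]; ring
      · exact (Real.sqrt_pos.mpr (by linarith)).ne'
    · refine ⟨.m24 1, Or.inl rfl, _, _, _, _, _, _, _, _, rfl, key 1 √q ?_ ?_⟩
      · rw [Real.sq_sqrt hpos.le]; ring
      · exact (Real.sqrt_pos.mpr hpos).ne'

/-- The case where every vector generates a subalgebra of dimension at most two. -/
theorem isListed_of_projectively_trivial {l : Plane →ₗ[ℝ] ℝ}
    (h : ∀ u v, m u v = l u • v + l v • u) : IsListed m := by
  by_cases hl : l = 0
  · subst hl
    refine ⟨.m00, trivial, LinearMap.proj 0, LinearMap.proj 1, _, _, _, _, _, _, rfl,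
      fun u h1 h2 => ?_, fun u v => ?_, fun u v => ?_⟩
    · funext k
      fin_cases k
      exacts [h1, h2]
    all_goals simp [h]
  · obtain ⟨φ, hφ⟩ : ∃ φ : Plane →ₗ[ℝ] ℝ, ∀ u, φ u = 0 → l u = 0 → u = 0 := by
      have hexp : ∀ u, l u = u 0 * l (Pi.single 0 1) + u 1 * l (Pi.single 1 1) := fun u => by
        conv_lhs => rw [show u = u 0 • Pi.single 0 1 + u 1 • Pi.single 1 1 by
          funext k; fin_cases k <;> simp]
        simp
      by_cases h0 : l (Pi.single 0 1) = 0
      · refine ⟨LinearMap.proj 0, fun u h1 h2 => ?_⟩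
        have h3 : l (Pi.single 1 1) ≠ 0 := fun h3 => hl (LinearMap.ext fun u => by
          rw [hexp, h0, h3]; simp)
        rw [hexp, h0] at h2
        have h4 : u 1 = 0 := by simpa [h3] using h2
        funext k
        fin_cases k
        exacts [h1, h4]
      · refine ⟨LinearMap.proj 1, fun u h1 h2 => ?_⟩
        have h5 : u 1 = 0 := h1
        rw [hexp, h5] at h2
        have h4 : u 0 = 0 := by simpa [h0] using h2
        funext k
        fin_cases k
        exacts [h4, h5]
    refine ⟨.m14 0, trivial, φ, l, _, _, _, _, _, _, rfl, hφ, fun u v => ?_, fun u v => ?_⟩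
    all_goals
      simp only [h, map_add, map_smul, smul_eq_mul]
      ring

/-! ### The cyclic case: roots of the minimal polynomial -/

/-- A real cubic has a root. -/
theorem exists_cubic_root (a b c : ℝ) : ∃ r : ℝ, r ^ 3 - a * r ^ 2 + b * r - c = 0 := by
  -- `N ^ 3 = (1 + |a| + |b| + |c|) N ^ 2` dominates the lower terms, so the cubic changes sign
  -- between `-N` and `N`.
  set N : ℝ := 1 + |a| + |b| + |c| with hN
  have hN1 : 1 ≤ N := by rw [hN]; linarith [abs_nonneg a, abs_nonneg b, abs_nonneg c]
  have hb : |b| * N ≤ |b| * N ^ 2 := by gcongr; nlinarith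
  have hc : |c| ≤ |c| * N ^ 2 := le_mul_of_one_le_right (abs_nonneg c) (by nlinarith)
  have hN3 : N ^ 3 = N ^ 2 + |a| * N ^ 2 + |b| * N ^ 2 + |c| * N ^ 2 := by
    rw [show N ^ 3 = N * N ^ 2 by ring]
    nth_rewrite 1 [hN]
    ring
  have hN2 : 0 < N ^ 2 := by positivity
  have ha1 : a * N ^ 2 ≤ |a| * N ^ 2 := by gcongr; exact le_abs_self a
  have ha2 : -a * N ^ 2 ≤ |a| * N ^ 2 := by gcongr; exact neg_le_abs a
  have hb1 : b * N ≤ |b| * N := by gcongr; exact le_abs_self b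
  have hb2 : -b * N ≤ |b| * N := by gcongr; exact neg_le_abs b
  have hc1 := le_abs_self c
  have hc2 := neg_le_abs c
  have hcont : Continuous fun r : ℝ => r ^ 3 - a * r ^ 2 + b * r - c := by fun_prop
  obtain ⟨r, -, hr⟩ := intermediate_value_Icc (show -N ≤ N by linarith) hcont.continuousOn
    (show (0 : ℝ) ∈ _ from ⟨by nlinarith, by nlinarith⟩)
  exact ⟨r, hr⟩

/-- The case of a cyclic generator: `x, y` are the coordinates with respect to a basis `w, w * w`,
and `r, s, t` are the elementary symmetric functions of the roots of the minimal polynomial. -/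
theorem isListed_of_cubic {x y : Plane →ₗ[ℝ] ℝ} {r s n k : ℝ}
    (h : HasTable m x y 0 1 (k - (r * s + n)) (r + s) (r * n - (r + s) * (r * s + n))
      (2 * k + (r + s) ^ 2 - (r * s + n))) : IsListed m := by
  -- With `w = t`, the second basis vector is `w * w = t² + k`, so a root `r` gives the character `r
  -- • x + (r ^ 2 + k) • y`. The other two roots are those of `t² - s t + n`, whose discriminant is
  -- tested here.
  rcases lt_trichotomy (s ^ 2 - 4 * n) 0 with hd | hd | hd
  · obtain ⟨β, hβ0, hβ⟩ : ∃ β : ℝ, β ≠ 0 ∧ n = (s / 2) ^ 2 + β ^ 2 :=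
      ⟨√(n - s ^ 2 / 4), (Real.sqrt_pos.mpr (by linarith)).ne', by
        rw [Real.sq_sqrt (by linarith)]; ring⟩
    obtain ⟨α, rfl⟩ : ∃ α, s = 2 * α := ⟨s / 2, by ring⟩
    have hn : n = α ^ 2 + β ^ 2 := by rw [hβ]; ring
    subst hn
    refine isListed_of_complex_character (φ := r • x + (r ^ 2 + k) • y)
      (α := α • x + (α ^ 2 - β ^ 2 + k) • y) (β := β • x + (2 * α * β) • y)
      (fun u v => ?_) (fun u v => ?_) (fun u h1 h2 => ?_)
    · simp only [LinearMap.add_apply, LinearMap.smul_apply, smul_eq_mul, h.fst, h.snd]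
      ring
    · simp only [LinearMap.add_apply, LinearMap.smul_apply, smul_eq_mul, h.fst, h.snd]
      ring
    · simp only [LinearMap.add_apply, LinearMap.smul_apply, smul_eq_mul] at h1 h2
      have h3 : x u = -(2 * α) * y u := by
        apply mul_left_cancel₀ hβ0
        linear_combination h2
      have h4 : ((r - α) ^ 2 + β ^ 2) * y u = 0 := by
        rw [h3] at h1
        linear_combination h1
      have h5 : y u = 0 := (mul_eq_zero.mp h4).resolve_left (by positivity)
      exact h.sep u (by rw [h3, h5, mul_zero]) h5
  · obtain ⟨α, rfl⟩ : ∃ α, s = 2 * α := ⟨s / 2, by ring⟩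
    have hn : n = α ^ 2 := by linear_combination -hd / 4
    subst hn
    by_cases hr : r = α
    · subst hr
      -- `δ₁` and `δ₂` are the first derivative and half the second derivative of `r • x + (r ^ 2 +
      -- k) • y` in `r`; at a double root only the first is used.
      refine isListed_of_second_order_derivation (φ := r • x + (r ^ 2 + k) • y)
        (δ₁ := x + (2 * r) • y) (δ₂ := y)
        (fun u v => ?_) (fun u v => ?_) (fun u h1 h2 => ?_)
      · simp only [LinearMap.add_apply, LinearMap.smul_apply, smul_eq_mul, h.fst, h.snd]
        ring
      · simp only [LinearMap.add_apply, LinearMap.smul_apply, smul_eq_mul, h.snd]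
        ring
      · simp only [LinearMap.add_apply, LinearMap.smul_apply, smul_eq_mul, h2] at h1
        exact h.sep u (by linarith) h2
    · refine isListed_of_derivation (φ₁ := r • x + (r ^ 2 + k) • y)
        (φ₂ := α • x + (α ^ 2 + k) • y) (δ := x + (2 * α) • y)
        (fun u v => ?_) (fun u v => ?_) (fun u h1 h2 => ?_)
      · simp only [LinearMap.add_apply, LinearMap.smul_apply, smul_eq_mul, h.fst, h.snd]
        ring
      · simp only [LinearMap.add_apply, LinearMap.smul_apply, smul_eq_mul, h.fst, h.snd]
        ring
      · simp only [LinearMap.add_apply, LinearMap.smul_apply, smul_eq_mul] at h1 h2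
        have h4 : (r - α) ^ 2 * y u = 0 := by linear_combination h1 - (r - α) * h2
        have h5 : y u = 0 := (mul_eq_zero.mp h4).resolve_left
          (pow_ne_zero 2 (sub_ne_zero.mpr hr))
        exact h.sep u (by rw [h5] at h2; linarith) h5
  · obtain ⟨β, hβ0, hβ⟩ : ∃ β : ℝ, β ≠ 0 ∧ n = (s / 2) ^ 2 - β ^ 2 :=
      ⟨√(s ^ 2 / 4 - n), (Real.sqrt_pos.mpr (by linarith)).ne', by
        rw [Real.sq_sqrt (by linarith)]; ring⟩
    obtain ⟨p, q, hpq, rfl, rfl⟩ : ∃ p q : ℝ, p ≠ q ∧ s = p + q ∧ n = p * q :=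
      ⟨s / 2 + β, s / 2 - β, fun h' => hβ0 (by linarith), by ring, by rw [hβ]; ring⟩
    have main : ∀ {r p q : ℝ}, r ≠ p → r ≠ q → p ≠ q →
        HasTable m x y 0 1 (k - (r * (p + q) + p * q)) (r + (p + q))
          (r * (p * q) - (r + (p + q)) * (r * (p + q) + p * q))
          (2 * k + (r + (p + q)) ^ 2 - (r * (p + q) + p * q)) → IsListed m := by
      intro r p q hp hq hpq h
      refine isListed_of_three_characters (φ₁ := r • x + (r ^ 2 + k) • y)
        (φ₂ := p • x + (p ^ 2 + k) • y) (φ₃ := q • x + (q ^ 2 + k) • y)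
        (fun u v => ?_) (fun u v => ?_) (fun u h1 h2 => ?_)
      · simp only [LinearMap.add_apply, LinearMap.smul_apply, smul_eq_mul, h.fst, h.snd]
        ring
      · simp only [LinearMap.add_apply, LinearMap.smul_apply, smul_eq_mul, h.fst, h.snd]
        ring
      · simp only [LinearMap.add_apply, LinearMap.smul_apply, smul_eq_mul] at h1 h2
        have h3 : x u = -(r + p) * y u := by
          apply mul_left_cancel₀ (sub_ne_zero.mpr hp)
          linear_combination h1
        have h4 : x u = -(r + q) * y u := by
          apply mul_left_cancel₀ (sub_ne_zero.mpr hq)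
          linear_combination h2
        have h5 : y u = 0 := by
          apply mul_left_cancel₀ (sub_ne_zero.mpr hpq)
          linear_combination h3 - h4
        exact h.sep u (by rw [h3, h5, mul_zero]) h5
    have double : ∀ {p q : ℝ}, p ≠ q → HasTable m x y 0 1 (k - (p * (p + q) + p * q)) (p + (p + q))
          (p * (p * q) - (p + (p + q)) * (p * (p + q) + p * q))
          (2 * k + (p + (p + q)) ^ 2 - (p * (p + q) + p * q)) → IsListed m := by
      intro p q hpq h
      refine isListed_of_derivation (φ₁ := q • x + (q ^ 2 + k) • y)
        (φ₂ := p • x + (p ^ 2 + k) • y) (δ := x + (2 * p) • y)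
        (fun u v => ?_) (fun u v => ?_) (fun u h1 h2 => ?_)
      · simp only [LinearMap.add_apply, LinearMap.smul_apply, smul_eq_mul, h.fst, h.snd]
        ring
      · simp only [LinearMap.add_apply, LinearMap.smul_apply, smul_eq_mul, h.fst, h.snd]
        ring
      · simp only [LinearMap.add_apply, LinearMap.smul_apply, smul_eq_mul] at h1 h2
        have h4 : (q - p) ^ 2 * y u = 0 := by linear_combination h1 - (q - p) * h2
        have h5 : y u = 0 := (mul_eq_zero.mp h4).resolve_left
          (pow_ne_zero 2 (sub_ne_zero.mpr hpq.symm))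
        exact h.sep u (by rw [h5] at h2; linarith) h5
    by_cases hp : r = p
    · subst hp
      exact double hpq h
    by_cases hq : r = q
    · subst hq
      refine double (Ne.symm hpq) ?_
      convert h using 1 <;> ring
    · exact main hp hq hpq h

theorem christoffelMul_eq (C : Fin 2 → Fin 2 → Fin 2 → ℝ) (u v : Plane) (k : Fin 2) :
    christoffelMul C u v k = C 0 0 k * u 0 * v 0 + C 0 1 k * u 0 * v 1 +
      (C 1 0 k * u 1 * v 0 + C 1 1 k * u 1 * v 1) := by
  simp [christoffelMul, Fin.sum_univ_two]

theorem isListed_christoffelMul (C : Fin 2 → Fin 2 → Fin 2 → ℝ)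
    (hC : ∀ i j k, C i j k = C j i k) : IsListed (christoffelMul C) := by
  set m := christoffelMul C with hm
  by_cases hw : ∃ w : Plane, w 0 * m w w 1 - w 1 * m w w 0 ≠ 0
  · obtain ⟨w, hw⟩ := hw
    set D := w 0 * m w w 1 - w 1 * m w w 0 with hD
    -- Cramer's rule: `x, y` is the basis dual to `w, m w w`.
    let x : Plane →ₗ[ℝ] ℝ := (m w w 1 / D) • LinearMap.proj 0 - (m w w 0 / D) • LinearMap.proj 1
    let y : Plane →ₗ[ℝ] ℝ := (w 0 / D) • LinearMap.proj 1 - (w 1 / D) • LinearMap.proj 0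
    have hx : ∀ u, x u = m w w 1 / D * u 0 - m w w 0 / D * u 1 := fun u => rfl
    have hy : ∀ u, y u = w 0 / D * u 1 - w 1 / D * u 0 := fun u => rfl
    have h1 : D * (1 / D) = 1 := mul_one_div_cancel hw
    have hexp : ∀ u, u = x u • w + y u • m w w := fun u => by
      funext k
      simp only [Pi.add_apply, Pi.smul_apply, smul_eq_mul, hx, hy]
      fin_cases k
      · simp only [Fin.zero_eta, Fin.isValue]
        linear_combination (-(u 0)) * h1 + u 0 / D * hD
      · simp only [Fin.mk_one, Fin.isValue]
        linear_combination (-(u 1)) * h1 + u 1 / D * hD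
    have hxw : x w = 1 := by rw [hx]; linear_combination h1 - 1 / D * hD
    have hyw : y w = 0 := by rw [hy]; ring
    have hxw' : x (m w w) = 0 := by rw [hx]; ring
    have hyw' : y (m w w) = 1 := by rw [hy]; linear_combination h1 - 1 / D * hD
    have hbil : ∀ (a b a' b' : ℝ) (z : Plane), m (a • w + b • z) (a' • w + b' • z) =
        (a * a') • m w w + (a * b' + b * a') • m w z + (b * b') • m z z := fun a b a' b' z => by
      funext k
      simp only [hm, christoffelMul_eq, Pi.add_apply, Pi.smul_apply, smul_eq_mul, hC 1 0 k]
      ring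
    have hmul : ∀ u v, m u v = (x u * x v) • m w w + (x u * y v + y u * x v) • m w (m w w) +
        (y u * y v) • m (m w w) (m w w) := fun u v => by
      conv_lhs => rw [hexp u, hexp v]
      exact hbil _ _ _ _ _
    have htab : HasTable m x y 0 1 (x (m w (m w w))) (y (m w (m w w)))
        (x (m (m w w) (m w w))) (y (m (m w w) (m w w))) := by
      refine ⟨fun u h1 h2 => ?_, fun u v => ?_, fun u v => ?_⟩
      · rw [hexp u, h1, h2]; simp
      · rw [hmul]
        simp only [map_add, map_smul, smul_eq_mul, hxw']
        ring
      · rw [hmul]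
        simp only [map_add, map_smul, smul_eq_mul, hyw']
        ring
    generalize x (m w (m w w)) = c at htab
    generalize y (m w (m w w)) = d at htab
    generalize x (m (m w w) (m w w)) = e at htab
    generalize y (m (m w w) (m w w)) = f at htab
    -- Matching the table with `ℝ[t]/(t³ - e₁t² + e₂t - e₃)` forces `e₁ = d`, `k = ρ_s(w, w) = f - d
    -- ^ 2 - c`, `e₂ = k - c` and `e₃ = e + e₁e₂`. After choosing a root `r`, `s` and `n` are the
    -- sum and product of the other two.
    obtain ⟨r, hr⟩ := exists_cubic_root d (f - d ^ 2 - c - c) (e + d * (f - d ^ 2 - c - c))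
    refine isListed_of_cubic (x := x) (y := y) (r := r) (s := d - r)
      (n := f - d ^ 2 - c - c - r * (d - r)) (k := f - d ^ 2 - c) ?_
    convert htab using 1
    · ring
    · ring
    · linear_combination hr
    · ring
  · push Not at hw
    -- The determinant of `w` and `m w w` is a binary cubic in `w`; vanishing on four pairwise
    -- independent vectors kills all its coefficients.
    have h1 := hw ![1, 0]
    have h2 := hw ![0, 1]
    have h3 := hw ![1, 1]
    have h4 := hw ![1, -1]
    simp [hm, christoffelMul_eq, hC 1 0] at h1 h2 h3 h4
    refine isListed_of_projectively_trivial
      (l := C 0 1 1 • LinearMap.proj 0 + C 0 1 0 • LinearMap.proj 1) (fun u v => ?_)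
    funext k
    simp only [hm, christoffelMul_eq, hC 1 0 k]
    fin_cases k
    · simp
      rw [show C 1 1 0 = 0 by linarith, show C 0 0 0 = 2 * C 0 1 1 by linarith]
      ring
    · simp
      rw [show C 0 0 1 = 0 by linarith, show C 1 1 1 = 2 * C 0 1 0 by linarith]
      ring

theorem exists_linearlyEquivalent_model {M : Connection} (hM : M.IsTypeA) :
    ∃ L : Label, L.Admissible ∧ LinearlyEquivalent M L.model := by
  obtain ⟨C, hC⟩ := hM
  obtain ⟨L, hL, x, y, a, b, c, d, e, f, hmodel, htab⟩ :=
    isListed_christoffelMul C (fun i j k => by rw [← hC i j k 0, ← hC j i k 0, M.symm])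
  exact ⟨L, hL, hmodel ▸ htab.linearlyEquivalent hC⟩

/-! ### The Ricci tensor and the solution space -/

/-- On constant fields the bracket vanishes and the curvature is the commutator of multiplication
operators. The result is already symmetric, so `ρ_s = ρ`. -/
theorem ricciMatrix_typeA (a b c d e f : ℝ) (p : Plane) :
    (typeA a b c d e f).ricciMatrix p = !![(a - d) * d + b * (f - c), c * d - b * e;
      c * d - b * e, (f - c) * c + (a - d) * e] := by
  have hcov : ∀ u v : Plane, (typeA a b c d e f).cov (fun _ => u) (fun _ => v) =
      fun _ => ![a * u 0 * v 0 + c * (u 0 * v 1 + u 1 * v 0) + e * u 1 * v 1,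
        b * u 0 * v 0 + d * (u 0 * v 1 + u 1 * v 0) + f * u 1 * v 1] := fun u v => by
    funext x k
    fin_cases k
    · simp [cov_typeA_apply_zero]
    · simp [cov_typeA_apply_one]
  have hlie : ∀ u v : Plane, VectorField.lieBracket ℝ (fun _ : Plane => u) (fun _ => v) =
      fun _ => 0 := fun u v => by
    funext x
    simp [VectorField.lieBracket]
  ext i j
  fin_cases i <;> fin_cases j <;>
    simp [Connection.ricciMatrix, Connection.ricci, Matrix.trace, Fin.sum_univ_two,
      Connection.curvature, hcov, hlie, basisVec] <;> ring

theorem symRicciMatrix_typeA (a b c d e f : ℝ) (p : Plane) :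
    (typeA a b c d e f).symRicciMatrix p = !![(a - d) * d + b * (f - c), c * d - b * e;
      c * d - b * e, (f - c) * c + (a - d) * e] := by
  rw [Connection.symRicciMatrix, ricciMatrix_typeA]
  ext i j
  fin_cases i <;> fin_cases j <;> simp <;> ring

theorem mem_quasiEinstein_typeA {a b c d e f : ℝ} {g : Plane → ℝ} :
    g ∈ (typeA a b c d e f).quasiEinstein ↔ ContDiff ℝ ∞ g ∧ ∀ p,
      pderiv 0 (pderiv 0 g) p = a * pderiv 0 g p + b * pderiv 1 g p -
        g p * ((a - d) * d + b * (f - c)) ∧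
      pderiv 0 (pderiv 1 g) p = c * pderiv 0 g p + d * pderiv 1 g p - g p * (c * d - b * e) ∧
      pderiv 1 (pderiv 0 g) p = c * pderiv 0 g p + d * pderiv 1 g p - g p * (c * d - b * e) ∧
      pderiv 1 (pderiv 1 g) p = e * pderiv 0 g p + f * pderiv 1 g p -
        g p * ((f - c) * c + (a - d) * e) := by
  refine and_congr_right fun _ => forall_congr' fun p => ?_
  rw [symRicciMatrix_typeA, ← Matrix.ext_iff]
  simp only [Fin.forall_fin_two, Connection.hessian, typeA, Fin.sum_univ_two, Matrix.add_apply,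
    Matrix.of_apply, Matrix.smul_apply, smul_eq_mul, Matrix.cons_val', Matrix.cons_val_zero,
    Matrix.cons_val_one, Matrix.zero_apply, Matrix.cons_val_fin_one, Fin.isValue]
  constructor
  · rintro ⟨⟨h1, h2⟩, h3, h4⟩
    refine ⟨?_, ?_, ?_, ?_⟩ <;> linarith
  · rintro ⟨h1, h2, h3, h4⟩
    refine ⟨⟨?_, ?_⟩, ?_, ?_⟩ <;> linarith

theorem hasDerivAt_comp_smul {g : Plane → ℝ} (hg : Differentiable ℝ g) (v : Plane) (t : ℝ) :
    HasDerivAt (fun s : ℝ => g (s • v)) (v 0 * pderiv 0 g (t • v) + v 1 * pderiv 1 g (t • v)) t := by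
  have h1 : HasDerivAt (fun s : ℝ => s • v) v t := by
    simpa using (hasDerivAt_id t).smul_const v
  have h2 := (hg (t • v)).hasFDerivAt.comp_hasDerivAt t h1
  refine h2.congr_deriv ?_
  have hv : v = v 0 • basisVec 0 + v 1 • basisVec 1 := by
    funext k; fin_cases k <;> simp [basisVec]
  have hlin : ∀ φ : Plane →L[ℝ] ℝ, φ v = v 0 * φ (basisVec 0) + v 1 * φ (basisVec 1) := fun φ => by
    conv_lhs => rw [hv]
    simp only [map_add, map_smul, smul_eq_mul]
  exact hlin _

/-- A solution of the quasi-Einstein equation is determined by its first jet at the origin. -/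
theorem eq_zero_of_mem_quasiEinstein {a b c d e f : ℝ} {g : Plane → ℝ}
    (hg : g ∈ (typeA a b c d e f).quasiEinstein) (h : g 0 = 0) (h0 : pderiv 0 g 0 = 0)
    (h1 : pderiv 1 g 0 = 0) : g = 0 := by
  obtain ⟨hs, heq⟩ := mem_quasiEinstein_typeA.mp hg
  funext v
  -- Along the ray `t ↦ t • v` the 1-jet of `g` satisfies a linear ODE with constant matrix `A`: the
  -- quasi-Einstein equation expresses the second derivatives through the jet. Uniqueness at `t = 1`
  -- gives `g v = 0`.
  let A : Matrix (Fin 3) (Fin 3) ℝ :=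
    v 0 • !![0, 1, 0; -((a - d) * d + b * (f - c)), a, b; -(c * d - b * e), c, d] +
    v 1 • !![0, 0, 1; -(c * d - b * e), c, d; -((f - c) * c + (a - d) * e), e, f]
  let B : (Fin 3 → ℝ) →L[ℝ] (Fin 3 → ℝ) := (Matrix.mulVecLin A).toContinuousLinearMap
  let F : ℝ → Fin 3 → ℝ := fun t => ![g (t • v), pderiv 0 g (t • v), pderiv 1 g (t • v)]
  have hF : ∀ t, HasDerivAt F (B (F t)) t := by
    intro t
    have hB : B (F t) = A.mulVec (F t) := rfl
    obtain ⟨e1, e2, e3, e4⟩ := heq (t • v)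
    rw [hB, hasDerivAt_pi]
    intro i
    fin_cases i
    · refine (hasDerivAt_comp_smul (hs.differentiable (by norm_num)) v t).congr_deriv ?_
      simp [A, F, Matrix.mulVec, dotProduct, Fin.sum_univ_three]
    · refine (hasDerivAt_comp_smul ((contDiff_pderiv 0 hs).differentiable (by norm_num)) v t).congr_deriv ?_
      rw [e1, e3]
      simp [A, F, Matrix.mulVec, dotProduct, Fin.sum_univ_three]
      ring
    · refine (hasDerivAt_comp_smul ((contDiff_pderiv 1 hs).differentiable (by norm_num)) v t).congr_deriv ?_
      rw [e2, e4]
      simp [A, F, Matrix.mulVec, dotProduct, Fin.sum_univ_three]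
      ring
  have hz : F = fun _ => 0 := ODE_solution_unique_univ (v := fun _ => B) (s := fun _ => Set.univ)
    (K := ‖B‖₊) (t₀ := 0) (fun _ => B.lipschitz.lipschitzOnWith) (fun t => ⟨hF t, trivial⟩)
    (fun t => ⟨by simpa using hasDerivAt_const t (0 : Fin 3 → ℝ), trivial⟩) (by
      funext i
      fin_cases i <;> simp [F, h, h0, h1])
  simpa [F] using congrFun (congrFun hz 1) 0

/-- The first jet at the origin of a solution of the quasi-Einstein equation. -/
noncomputable def jet (M : Connection) : M.quasiEinstein →ₗ[ℝ] (Fin 3 → ℝ) where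
  toFun g := ![g.1 0, pderiv 0 g.1 0, pderiv 1 g.1 0]
  map_add' g h := by
    have hg := g.2.1.differentiable (by norm_num)
    have hh := h.2.1.differentiable (by norm_num)
    funext i
    fin_cases i <;> simp [pderiv_add _ hg hh]
  map_smul' r g := by
    have hg := g.2.1.differentiable (by norm_num)
    funext i
    fin_cases i <;> simp [pderiv_smul _ r hg]

theorem jet_injective (a b c d e f : ℝ) : Function.Injective (jet (typeA a b c d e f)) := by
  rw [injective_iff_map_eq_zero]
  intro g hg
  exact Subtype.ext (eq_zero_of_mem_quasiEinstein g.2 (congrFun hg 0) (congrFun hg 1)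
    (congrFun hg 2))

/-- Three solutions with linearly independent jets at the origin form a basis. -/
theorem quasiEinstein_eq_S {a b c d e f : ℝ} {g₀ g₁ g₂ : Plane → ℝ}
    (hg₀ : g₀ ∈ (typeA a b c d e f).quasiEinstein) (hg₁ : g₁ ∈ (typeA a b c d e f).quasiEinstein)
    (hg₂ : g₂ ∈ (typeA a b c d e f).quasiEinstein)
    (hdet : (!![g₀ 0, pderiv 0 g₀ 0, pderiv 1 g₀ 0; g₁ 0, pderiv 0 g₁ 0, pderiv 1 g₁ 0;
      g₂ 0, pderiv 0 g₂ 0, pderiv 1 g₂ 0] : Matrix _ _ ℝ).det ≠ 0) :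
    (typeA a b c d e f).quasiEinstein = S g₀ g₁ g₂ ∧ Module.finrank ℝ (S g₀ g₁ g₂) = 3 := by
  set Q := (typeA a b c d e f).quasiEinstein with hQ
  have hinj := jet_injective a b c d e f
  have : FiniteDimensional ℝ Q := FiniteDimensional.of_injective _ hinj
  have hle : Module.finrank ℝ Q ≤ 3 := by
    simpa using LinearMap.finrank_le_finrank_of_injective hinj
  let G : Fin 3 → Q := ![⟨g₀, hg₀⟩, ⟨g₁, hg₁⟩, ⟨g₂, hg₂⟩]
  have hind : LinearIndependent ℝ (Q.subtype ∘ G) := by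
    have h1 := Matrix.linearIndependent_rows_of_det_ne_zero hdet
    have h2 : LinearIndependent ℝ G := by
      refine LinearIndependent.of_comp (jet (typeA a b c d e f)) ?_
      have h3 : jet (typeA a b c d e f) ∘ G = (!![g₀ 0, pderiv 0 g₀ 0, pderiv 1 g₀ 0;
          g₁ 0, pderiv 0 g₁ 0, pderiv 1 g₁ 0; g₂ 0, pderiv 0 g₂ 0, pderiv 1 g₂ 0] :
          Matrix (Fin 3) (Fin 3) ℝ) := by
        funext i
        fin_cases i <;> rfl
      rw [h3]
      exact h1
    exact h2.map' Q.subtype (Submodule.ker_subtype Q)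
  have hS : S g₀ g₁ g₂ = Submodule.span ℝ (Set.range (Q.subtype ∘ G)) := by
    rw [S]
    congr 1
    ext h
    simp [G, Fin.exists_fin_succ, eq_comm]
  have hfin : Module.finrank ℝ (S g₀ g₁ g₂) = 3 := by
    rw [hS, finrank_span_eq_card hind]
    rfl
  refine ⟨(Submodule.eq_of_le_of_finrank_le ?_ (by rw [hfin]; exact hle)).symm, hfin⟩
  rw [hS, Submodule.span_le]
  rintro _ ⟨i, rfl⟩
  exact (G i).2

/-! ### Verification of the listed models -/

section PartialDerivatives

variable {f g : Plane → ℝ} (i : Fin 2)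

theorem pderiv_fun_const (c : ℝ) : pderiv i (fun _ => c) = fun _ => 0 := by
  funext x
  simp [pderiv]

theorem pderiv_coord (j : Fin 2) : pderiv i (fun x => x j) = fun _ => if j = i then 1 else 0 := by
  funext x
  have : HasFDerivAt (fun x : Plane => x j) (ContinuousLinearMap.proj (R := ℝ) j) x :=
    (ContinuousLinearMap.proj (R := ℝ) (φ := fun _ : Fin 2 => ℝ) j).hasFDerivAt
  rw [pderiv, this.fderiv]
  simp [basisVec, Pi.single_apply]

theorem pderiv_fun_add (hf : Differentiable ℝ f) (hg : Differentiable ℝ g) :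
    pderiv i (fun x => f x + g x) = fun x => pderiv i f x + pderiv i g x :=
  pderiv_add i hf hg

theorem pderiv_fun_sub (hf : Differentiable ℝ f) (hg : Differentiable ℝ g) :
    pderiv i (fun x => f x - g x) = fun x => pderiv i f x - pderiv i g x := by
  funext x
  simp [pderiv, fderiv_fun_sub (hf x) (hg x)]

theorem pderiv_fun_neg : pderiv i (fun x => -f x) = fun x => -pderiv i f x := by
  funext x
  simp [pderiv]

theorem pderiv_fun_mul (hf : Differentiable ℝ f) (hg : Differentiable ℝ g) :
    pderiv i (fun x => f x * g x) = fun x => pderiv i f x * g x + f x * pderiv i g x := by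
  funext x
  simp [pderiv, fderiv_fun_mul (hf x) (hg x)]
  ring

theorem pderiv_fun_sq (hf : Differentiable ℝ f) :
    pderiv i (fun x => f x ^ 2) = fun x => 2 * f x * pderiv i f x := by
  simp only [pow_two, pderiv_fun_mul i hf hf]
  funext x
  ring

theorem pderiv_exp (hf : Differentiable ℝ f) :
    pderiv i (fun x => Real.exp (f x)) = fun x => Real.exp (f x) * pderiv i f x := by
  funext x
  simp [pderiv, fderiv_exp (hf x)]

theorem pderiv_cos (hf : Differentiable ℝ f) :
    pderiv i (fun x => Real.cos (f x)) = fun x => -Real.sin (f x) * pderiv i f x := by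
  funext x
  rw [pderiv, ((hf x).hasFDerivAt.cos).fderiv]
  simp [pderiv]

theorem pderiv_sin (hf : Differentiable ℝ f) :
    pderiv i (fun x => Real.sin (f x)) = fun x => Real.cos (f x) * pderiv i f x := by
  funext x
  rw [pderiv, ((hf x).hasFDerivAt.sin).fderiv]
  simp [pderiv]

end PartialDerivatives

theorem rank_two_of_det_ne_zero {A : Matrix (Fin 2) (Fin 2) ℝ} (h : A.det ≠ 0) : A.rank = 2 := by
  simpa using Matrix.rank_of_isUnit A ((Matrix.isUnit_iff_isUnit_det A).mpr h.isUnit)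

theorem rank_one_of_ne_zero {t : ℝ} (ht : t ≠ 0) : (!![0, 0; 0, t] : Matrix _ _ ℝ).rank = 1 := by
  classical
  have : (!![0, 0; 0, t] : Matrix _ _ ℝ) = Matrix.diagonal ![0, t] := by
    ext i j
    fin_cases i <;> fin_cases j <;> simp
  rw [this, Matrix.rank_diagonal, Fintype.card_subtype]
  simp [Fin.univ_succ, Finset.filter_insert, Finset.filter_singleton, ht]

theorem rank_ricciMatrix_model (L : Label) (hL : L.Admissible) (p : Plane) :
    (L.model.ricciMatrix p).rank = L.nu := by
  have zero : ∀ {A : Matrix (Fin 2) (Fin 2) ℝ}, A = !![0, 0; 0, 0] → A.rank = 0 := by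
    rintro _ rfl
    rw [show (!![0, 0; 0, 0] : Matrix _ _ ℝ) = 0 by ext i j; fin_cases i <;> fin_cases j <;> rfl,
      Matrix.rank_zero]
  have one : ∀ {A : Matrix (Fin 2) (Fin 2) ℝ} (t : ℝ), t ≠ 0 → A = !![0, 0; 0, t] →
      A.rank = 1 := by
    rintro _ t ht rfl
    exact rank_one_of_ne_zero ht
  cases L <;> simp only [Label.model, Label.nu, ricciMatrix_typeA]
  case m11 => exact one 1 one_ne_zero (by norm_num)
  case m12 c =>
    exact one (c * (c + 1)) (mul_ne_zero hL.1 fun h => hL.2 (by linarith)) (by ring_nf)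
  case m13 c =>
    exact one (c * (c + 1)) (mul_ne_zero hL.1 fun h => hL.2 (by linarith)) (by ring_nf)
  case m14 c => exact one 1 one_ne_zero (by norm_num)
  case m15 c => exact one (1 + c ^ 2) (by positivity) (by norm_num)
  case m21 a₁ a₂ =>
    obtain ⟨ha, hD⟩ := hL
    have hD' : a₁ + a₂ - 1 ≠ 0 := sub_ne_zero.mpr hD
    apply rank_two_of_det_ne_zero
    rw [Matrix.det_fin_two_of]
    have : a₁ * a₂ / (a₁ + a₂ - 1) ≠ 0 := div_ne_zero ha hD'
    convert neg_ne_zero.mpr this using 1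
    field_simp
    ring
  case m22 b₁ b₂ =>
    obtain ⟨hb, h0⟩ := hL
    have hb' : b₁ - 1 ≠ 0 := sub_ne_zero.mpr hb
    apply rank_two_of_det_ne_zero
    rw [Matrix.det_fin_two_of]
    have : (b₁ ^ 2 + b₂ ^ 2) / (b₁ - 1) ≠ 0 := by
      refine div_ne_zero (fun h => h0 ?_) hb'
      rw [Prod.mk.injEq]
      constructor <;> nlinarith
    convert this using 1
    field_simp
    ring
  case m23 c =>
    apply rank_two_of_det_ne_zero
    rw [Matrix.det_fin_two_of]
    norm_num
    exact hL
  case m24 s =>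
    apply rank_two_of_det_ne_zero
    rw [Matrix.det_fin_two_of]
    rcases hL with rfl | rfl <;> norm_num
  all_goals exact zero (by norm_num)

-- Each listed function is checked against the equations, and the determinant of the three jets at
-- the origin is shown to be nonzero. For `m21` and `m22` this is where `a₁ + a₂ ≠ 1` and `b₁ ≠ 1`
-- give independence.
set_option linter.unusedSimpArgs false in
set_option maxHeartbeats 2000000 in
theorem quasiEinstein_model (L : Label) (hL : L.Admissible) :
    L.model.quasiEinstein = L.space ∧ Module.finrank ℝ L.space = 3 := by
  cases L <;> simp only [Label.model, Label.space]
  case m21 a₁ a₂ =>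
    obtain ⟨ha, hD⟩ := hL
    have hD' : a₁ + a₂ - 1 ≠ 0 := sub_ne_zero.mpr hD
    apply quasiEinstein_eq_S
    iterate 3 (
      rw [mem_quasiEinstein_typeA]
      refine ⟨by fun_prop, fun p => ?_⟩
      simp (disch := fun_prop) only [pderiv_exp, pderiv_cos, pderiv_sin, pderiv_fun_neg, pderiv_fun_mul, pderiv_fun_add,
        pderiv_fun_sub, pderiv_fun_sq, pderiv_coord, pderiv_fun_const,
        Fin.isValue, zero_ne_one, one_ne_zero, if_true, if_false]
      refine ⟨?_, ?_, ?_, ?_⟩ <;> field_simp <;> ring)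
    rw [Matrix.det_fin_three]
    simp (disch := fun_prop) [pderiv_exp, pderiv_cos, pderiv_sin, pderiv_fun_neg, pderiv_fun_mul, pderiv_fun_add,
      pderiv_fun_sub, pderiv_fun_sq, pderiv_coord, pderiv_fun_const]
    exact fun h => hD' (by linear_combination -h)
  case m22 b₁ b₂ =>
    obtain ⟨hb, h0⟩ := hL
    have hb' : b₁ - 1 ≠ 0 := sub_ne_zero.mpr hb
    apply quasiEinstein_eq_S
    iterate 3 (
      rw [mem_quasiEinstein_typeA]
      refine ⟨by fun_prop, fun p => ?_⟩
      simp (disch := fun_prop) only [pderiv_exp, pderiv_cos, pderiv_sin, pderiv_fun_neg, pderiv_fun_mul, pderiv_fun_add,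
        pderiv_fun_sub, pderiv_fun_sq, pderiv_coord, pderiv_fun_const,
        Fin.isValue, zero_ne_one, one_ne_zero, if_true, if_false]
      refine ⟨?_, ?_, ?_, ?_⟩ <;> field_simp <;> ring)
    rw [Matrix.det_fin_three]
    simp (disch := fun_prop) [pderiv_exp, pderiv_cos, pderiv_sin, pderiv_fun_neg, pderiv_fun_mul, pderiv_fun_add,
      pderiv_fun_sub, pderiv_fun_sq, pderiv_coord, pderiv_fun_const]
    exact fun h => hb' (by linear_combination -h)
  all_goals
    apply quasiEinstein_eq_S
    iterate 3 (
      rw [mem_quasiEinstein_typeA]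
      refine ⟨by fun_prop, fun p => ?_⟩
      simp (disch := fun_prop) only [pderiv_exp, pderiv_cos, pderiv_sin, pderiv_fun_neg, pderiv_fun_mul, pderiv_fun_add,
        pderiv_fun_sub, pderiv_fun_sq, pderiv_coord, pderiv_fun_const,
        Fin.isValue, zero_ne_one, one_ne_zero, if_true, if_false]
      refine ⟨?_, ?_, ?_, ?_⟩ <;> ring)
    rw [Matrix.det_fin_three]
    simp (disch := fun_prop) [pderiv_exp, pderiv_cos, pderiv_sin, pderiv_fun_neg, pderiv_fun_mul, pderiv_fun_add,
      pderiv_fun_sub, pderiv_fun_sq, pderiv_coord, pderiv_fun_const]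

end AffinePlane

theorem theorem3 :
    (∀ M : AffinePlane.Connection, M.IsTypeA →
      ∃ L : AffinePlane.Label, L.Admissible ∧ AffinePlane.LinearlyEquivalent M L.model) ∧
    (∀ L : AffinePlane.Label, L.Admissible →
      L.model.quasiEinstein = L.space ∧
      Module.finrank ℝ L.space = 3 ∧
      ∀ p : AffinePlane.Plane, (L.model.ricciMatrix p).rank = L.nu) :=
  ⟨fun _ hM => AffinePlane.exists_linearlyEquivalent_model hM, fun L hL =>
    ⟨(AffinePlane.quasiEinstein_model L hL).1, (AffinePlane.quasiEinstein_model L hL).2,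
      AffinePlane.rank_ricciMatrix_model L hL⟩⟩
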